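/- Let $\Bbbk$ be a field and $n\ge 2$ an integer with $\operatorname{char}(\Bbbk)\nmid n$. Let $Q_n$ be the cyclic quiver with vertices $1,\dots,n$ and exactly one arrow $i\to i+1$ for each $i$ (indices modulo $n$), let $R$ be the two-sided ideal of the path algebra $\Bbbk Q_n$ generated by the arrows, and for $k\ge 2$ put $\Lambda_n^{(k)}=\Bbbk Q_n/R^k$. Then, for every $k\ge 2$, the algebra $\Bbbk[x]/(x^k)$ is symmetrically separably equivalent to $\Lambda_n^{(k)}$. Here two finite-dimensional $\Bbbk$-algebras $A$ and $B$ are called symmetrically separably equivalent if there are finite-dimensional bimodules ${}_AM_B$ and ${}_BN_A$ (on which $\Bbbk$ acts centrally), each projective as a left module and as a right module, such that $M\otimes_B N\simeq A\oplus X$ as $A$-$A$-bimodules and $N\otimes_A M\simeq B\oplus Y$ as $B$-$B$-bimodules, for some bimodules $X$ and $Y$, and such that the functors $M\otimes_B-\colon B\text{-mod}\to A\text{-mod}$ and $N\otimes_A-\colon A\text{-mod}\to B\text{-mod}$ between the categories of finite-dimensional left modules are biadjoint, that is, each is both left and right adjoint to the other. -/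

import Mathlib

open CategoryTheory MulOpposite
open scoped TensorProduct Polynomial

universe u v w

noncomputable section

/-! ### Path algebras -/

/-- All paths of a quiver, with source and target not fixed. -/
abbrev QuiverPath (V : Type v) [Quiver.{w} V] : Type (max v w) :=
  Σ a b : V, Quiver.Path a b

/-- The path algebra of a quiver: the vector space with basis all paths. The product is defined
below. -/
def PathAlgebra (k : Type u) (V : Type v) [Field k] [Quiver.{w} V] : Type (max u v w) :=
  QuiverPath V →₀ k

namespace PathAlgebra

variable (k : Type u) {V : Type v} [Field k] [Quiver.{w} V]

instance : AddCommGroup (PathAlgebra k V) :=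
  inferInstanceAs (AddCommGroup (QuiverPath V →₀ k))

instance : Module k (PathAlgebra k V) :=
  inferInstanceAs (Module k (QuiverPath V →₀ k))

variable (V) in
/-- The basis of the path algebra that consists of the paths. -/
def pathBasis : Module.Basis (QuiverPath V) k (PathAlgebra k V) :=
  Module.Basis.ofRepr (LinearEquiv.refl k (QuiverPath V →₀ k))

/-- The basis element given by a path. -/
def ofPath {a b : V} (p : Quiver.Path a b) : PathAlgebra k V :=
  pathBasis k V ⟨a, b, p⟩

open Classical in
/-- The product `p * q` of two paths, composed from right to left like maps: it is the path
"first `q`, then `p`" if `q` ends where `p` starts, and zero otherwise. -/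
def pathMul (p q : QuiverPath V) : PathAlgebra k V :=
  if h : q.2.1 = p.1 then ofPath k (q.2.2.comp (p.2.2.cast h.symm rfl)) else 0

/-- The bilinear extension of the product of paths. -/
def mulHom : PathAlgebra k V →ₗ[k] PathAlgebra k V →ₗ[k] PathAlgebra k V :=
  (pathBasis k V).constr k fun p => (pathBasis k V).constr k fun q => pathMul k p q

instance : Mul (PathAlgebra k V) := ⟨fun x y => mulHom k x y⟩

/-- The unit is the sum of the paths of length zero. -/
instance [Fintype V] : One (PathAlgebra k V) :=
  ⟨∑ a : V, ofPath k (Quiver.Path.nil : Quiver.Path a a)⟩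

variable {k}

theorem mul_def (x y : PathAlgebra k V) : x * y = mulHom k x y := rfl

theorem one_def [Fintype V] :
    (1 : PathAlgebra k V) = ∑ a : V, ofPath k (Quiver.Path.nil : Quiver.Path a a) := rfl

theorem ofPath_mul_ofPath {a b c : V} (p : Quiver.Path b c) (q : Quiver.Path a b) :
    ofPath k p * ofPath k q = ofPath k (q.comp p) := by
  rw [mul_def, mulHom, ofPath, ofPath, Module.Basis.constr_basis, Module.Basis.constr_basis,
    pathMul]
  simp

theorem ofPath_mul_ofPath_of_ne {a b c d : V} (p : Quiver.Path c d) (q : Quiver.Path a b)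
    (h : b ≠ c) : ofPath k p * ofPath k q = 0 := by
  rw [mul_def, mulHom, ofPath, ofPath, Module.Basis.constr_basis, Module.Basis.constr_basis,
    pathMul]
  simp [h]

theorem induction_on {P : PathAlgebra k V → Prop} (x : PathAlgebra k V)
    (path : ∀ {a b : V} (p : Quiver.Path a b), P (ofPath k p))
    (zero : P 0) (add : ∀ x y, P x → P y → P (x + y)) (smul : ∀ (c : k) x, P x → P (c • x)) :
    P x := by
  have hx : x ∈ Submodule.span k (Set.range (pathBasis k V)) := by
    rw [(pathBasis k V).span_eq]; exact Submodule.mem_top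
  induction hx using Submodule.span_induction with
  | mem x hx => obtain ⟨⟨a, b, p⟩, rfl⟩ := hx; exact path p
  | zero => exact zero
  | add x y _ _ hx hy => exact add x y hx hy
  | smul c x _ hx => exact smul c x hx

protected theorem mul_add' (x y z : PathAlgebra k V) : x * (y + z) = x * y + x * z := by
  simp only [mul_def, map_add]

protected theorem add_mul' (x y z : PathAlgebra k V) : (x + y) * z = x * z + y * z := by
  simp only [mul_def, map_add, LinearMap.add_apply]

protected theorem smul_mul' (c : k) (x y : PathAlgebra k V) : (c • x) * y = c • (x * y) := by
  simp only [mul_def, map_smul, LinearMap.smul_apply]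

protected theorem mul_smul' (c : k) (x y : PathAlgebra k V) : x * (c • y) = c • (x * y) := by
  simp only [mul_def, map_smul]

protected theorem zero_mul' (x : PathAlgebra k V) : 0 * x = 0 := by
  simp only [mul_def, map_zero, LinearMap.zero_apply]

protected theorem mul_zero' (x : PathAlgebra k V) : x * 0 = 0 := by
  simp only [mul_def, map_zero]

protected theorem mul_assoc' (x y z : PathAlgebra k V) : x * y * z = x * (y * z) := by
  induction x using induction_on with
  | zero => simp only [PathAlgebra.zero_mul']
  | add x x' h h' => simp only [PathAlgebra.add_mul', h, h']
  | smul c x h => simp only [PathAlgebra.smul_mul', h]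
  | path p =>
  induction y using induction_on with
  | zero => simp only [PathAlgebra.zero_mul', PathAlgebra.mul_zero']
  | add x x' h h' => simp only [PathAlgebra.add_mul', PathAlgebra.mul_add', h, h']
  | smul c x h => simp only [PathAlgebra.smul_mul', PathAlgebra.mul_smul', h]
  | path q =>
  induction z using induction_on with
  | zero => simp only [PathAlgebra.mul_zero']
  | add x x' h h' => simp only [PathAlgebra.mul_add', h, h']
  | smul c x h => simp only [PathAlgebra.mul_smul', h]
  | path r =>
  rename_i a b c d e f
  by_cases h₁ : d = a
  · subst h₁
    by_cases h₂ : f = c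
    · subst h₂
      simp only [ofPath_mul_ofPath, Quiver.Path.comp_assoc]
    · simp only [ofPath_mul_ofPath, ofPath_mul_ofPath_of_ne _ _ h₂, PathAlgebra.mul_zero']
  · by_cases h₂ : f = c
    · subst h₂
      simp only [ofPath_mul_ofPath, ofPath_mul_ofPath_of_ne _ _ h₁, PathAlgebra.zero_mul']
    · simp only [ofPath_mul_ofPath_of_ne _ _ h₁, ofPath_mul_ofPath_of_ne _ _ h₂,
        PathAlgebra.zero_mul', PathAlgebra.mul_zero']

protected theorem one_mul' [Fintype V] (x : PathAlgebra k V) : 1 * x = x := by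
  induction x using induction_on with
  | zero => exact PathAlgebra.mul_zero' _
  | add x x' h h' => rw [PathAlgebra.mul_add', h, h']
  | smul c x h => rw [PathAlgebra.mul_smul', h]
  | path p =>
  rename_i a b
  rw [one_def, mul_def, map_sum, LinearMap.sum_apply, Finset.sum_eq_single b]
  · exact (ofPath_mul_ofPath _ _).trans (by simp)
  · intro c _ hc
    exact ofPath_mul_ofPath_of_ne _ _ hc.symm
  · simp

protected theorem mul_one' [Fintype V] (x : PathAlgebra k V) : x * 1 = x := by
  induction x using induction_on with
  | zero => exact PathAlgebra.zero_mul' _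
  | add x x' h h' => rw [PathAlgebra.add_mul', h, h']
  | smul c x h => rw [PathAlgebra.smul_mul', h]
  | path p =>
  rename_i a b
  rw [one_def, mul_def, map_sum, Finset.sum_eq_single a]
  · exact (ofPath_mul_ofPath _ _).trans (by simp)
  · intro c _ hc
    exact ofPath_mul_ofPath_of_ne _ _ hc
  · simp

instance [Fintype V] : Ring (PathAlgebra k V) where
  __ := instAddCommGroup k
  left_distrib := PathAlgebra.mul_add'
  right_distrib := PathAlgebra.add_mul'
  zero_mul := PathAlgebra.zero_mul'
  mul_zero := PathAlgebra.mul_zero'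
  mul_assoc := PathAlgebra.mul_assoc'
  one_mul := PathAlgebra.one_mul'
  mul_one := PathAlgebra.mul_one'

instance [Fintype V] : Algebra k (PathAlgebra k V) :=
  Algebra.ofModule PathAlgebra.smul_mul' PathAlgebra.mul_smul'

variable (k V) in
/-- The two-sided ideal of the path algebra that is generated by the arrows. -/
def arrowIdeal [Fintype V] : Ideal (PathAlgebra k V) :=
  (TwoSidedIdeal.span
    {x : PathAlgebra k V | ∃ (a b : V) (α : a ⟶ b), x = ofPath k α.toPath}).asIdeal

instance [Fintype V] : (arrowIdeal k V).IsTwoSided := by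
  unfold arrowIdeal; infer_instance

end PathAlgebra

/-! ### The self-injective Nakayama algebras -/

/-- The vertices of the cyclic quiver with `n` vertices, numbered from `0` to `n - 1`. -/
def CyclicQuiver (n : ℕ) : Type := Fin n

instance (n : ℕ) : Fintype (CyclicQuiver n) := inferInstanceAs (Fintype (Fin n))

instance (n : ℕ) : DecidableEq (CyclicQuiver n) := inferInstanceAs (DecidableEq (Fin n))

/-- The number of a vertex, between `0` and `n - 1`. -/
def CyclicQuiver.toNat {n : ℕ} (i : CyclicQuiver n) : ℕ := Fin.val i

/-- The cyclic quiver has exactly one arrow from each `i` to `i + 1` modulo `n`, and no others. -/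
instance (n : ℕ) : Quiver.{0} (CyclicQuiver n) :=
  ⟨fun i j => PLift (j.toNat = (i.toNat + 1) % n)⟩

/-- The path algebra of the cyclic quiver with `n` vertices modulo the `m`-th power of the ideal
generated by the arrows. -/
abbrev NakayamaAlgebra (k : Type u) [Field k] (n m : ℕ) : Type u :=
  PathAlgebra k (CyclicQuiver n) ⧸ (PathAlgebra.arrowIdeal k (CyclicQuiver n)) ^ m

/-! ### Tensor products over a noncommutative ring -/

section BalancedTensor

/-- The tensor product `M ⊗_B N` of a right `B`-module and a left `B`-module, as an abelian
group. -/
def BalancedTensor (B : Type u) (M : Type v) (N : Type w) [Ring B] [AddCommGroup M]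
    [Module Bᵐᵒᵖ M] [AddCommGroup N] [Module B N] : Type (max v w) :=
  (M ⊗[ℤ] N) ⧸ Submodule.span ℤ
    {t : M ⊗[ℤ] N | ∃ (m : M) (b : B) (n : N), t = (op b • m) ⊗ₜ[ℤ] n - m ⊗ₜ[ℤ] (b • n)}

namespace BalancedTensor

variable {B : Type*} {M M' M'' N N' N'' : Type*} [Ring B]
  [AddCommGroup M] [Module Bᵐᵒᵖ M] [AddCommGroup M'] [Module Bᵐᵒᵖ M']
  [AddCommGroup M''] [Module Bᵐᵒᵖ M'']
  [AddCommGroup N] [Module B N] [AddCommGroup N'] [Module B N'] [AddCommGroup N''] [Module B N'']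

instance : AddCommGroup (BalancedTensor B M N) :=
  inferInstanceAs (AddCommGroup ((M ⊗[ℤ] N) ⧸ Submodule.span ℤ
    {t : M ⊗[ℤ] N | ∃ (m : M) (b : B) (n : N), t = (op b • m) ⊗ₜ[ℤ] n - m ⊗ₜ[ℤ] (b • n)}))

variable (B) in
/-- The class of a pure tensor. -/
def tmul (m : M) (n : N) : BalancedTensor B M N :=
  Submodule.Quotient.mk (m ⊗ₜ[ℤ] n)

theorem smul_tmul (b : B) (m : M) (n : N) : tmul B (op b • m) n = tmul B m (b • n) :=
  (Submodule.Quotient.eq _).2 (Submodule.subset_span ⟨m, b, n, rfl⟩)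

theorem add_tmul (m m' : M) (n : N) : tmul B (m + m') n = tmul B m n + tmul B m' n := by
  simp only [tmul, TensorProduct.add_tmul]; rfl

theorem tmul_add (m : M) (n n' : N) : tmul B m (n + n') = tmul B m n + tmul B m n' := by
  simp only [tmul, TensorProduct.tmul_add]; rfl

theorem zero_tmul (n : N) : tmul B (0 : M) n = 0 := by
  simp only [tmul, TensorProduct.zero_tmul]; rfl

theorem tmul_zero (m : M) : tmul B m (0 : N) = 0 := by
  simp only [tmul, TensorProduct.tmul_zero]; rfl

theorem induction_on {P : BalancedTensor B M N → Prop} (t : BalancedTensor B M N)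
    (zero : P 0) (tmul : ∀ m n, P (tmul B m n)) (add : ∀ x y, P x → P y → P (x + y)) : P t := by
  induction t using Submodule.Quotient.induction_on with
  | _ x =>
  induction x using TensorProduct.induction_on with
  | zero => exact zero
  | tmul m n => exact tmul m n
  | add x y hx hy => exact add _ _ hx hy

theorem hom_ext {P : Type*} [AddCommGroup P] {f g : BalancedTensor B M N →+ P}
    (h : ∀ m n, f (tmul B m n) = g (tmul B m n)) : f = g := by
  ext t
  induction t using induction_on with
  | zero => simp
  | tmul m n => exact h m n
  | add x y hx hy => simp [hx, hy]

/-- A biadditive balanced map induces a map on the tensor product. -/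
def lift {P : Type*} [AddCommGroup P] (f : M →+ N →+ P)
    (hf : ∀ m (b : B) n, f (op b • m) n = f m (b • n)) : BalancedTensor B M N →+ P :=
  (Submodule.liftQ _ (TensorProduct.liftAddHom f fun r m n => by simp).toIntLinearMap (by
    rw [Submodule.span_le]
    rintro _ ⟨m, b, n, rfl⟩
    simp [hf])).toAddMonoidHom

@[simp]
theorem lift_tmul {P : Type*} [AddCommGroup P] (f : M →+ N →+ P)
    (hf : ∀ m (b : B) n, f (op b • m) n = f m (b • n)) (m : M) (n : N) :
    lift f hf (tmul B m n) = f m n := rfl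

/-- Functoriality of the tensor product in both arguments. -/
def map (f : M →ₗ[Bᵐᵒᵖ] M') (g : N →ₗ[B] N') : BalancedTensor B M N →+ BalancedTensor B M' N' :=
  lift (AddMonoidHom.mk' (fun m => AddMonoidHom.mk' (fun n => tmul B (f m) (g n))
      (by intro n n'; simp [tmul_add]))
    (by intro m m'; ext n; simp [add_tmul])) (by intro m b n; simp [smul_tmul])

@[simp]
theorem map_tmul (f : M →ₗ[Bᵐᵒᵖ] M') (g : N →ₗ[B] N') (m : M) (n : N) :
    map f g (tmul B m n) = tmul B (f m) (g n) := rfl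

variable (B M N)

/-- The action of a ring `A` on `M ⊗_B N` through an action on `M`:
`a • (m ⊗ n) = (a • m) ⊗ n`. -/
abbrev leftModule (A : Type*) [Ring A] [Module A M] [SMulCommClass A Bᵐᵒᵖ M] :
    Module A (BalancedTensor B M N) :=
  Module.compHom (R := AddMonoid.End (BalancedTensor B M N)) _
    { toFun := fun a => map (DistribSMul.toLinearMap Bᵐᵒᵖ M a) LinearMap.id
      map_one' := hom_ext fun m n => congrArg (tmul B · n) (one_smul A m)
      map_mul' := fun a a' => hom_ext fun m n => congrArg (tmul B · n) (mul_smul a a' m)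
      map_zero' := hom_ext fun m n => (congrArg (tmul B · n) (zero_smul A m)).trans (zero_tmul n)
      map_add' := fun a a' => hom_ext fun m n =>
        (congrArg (tmul B · n) (add_smul a a' m)).trans (add_tmul _ _ n) }

/-- The action of a ring `C` on `M ⊗_B N` through an action on `N`:
`c • (m ⊗ n) = m ⊗ (c • n)`. -/
abbrev rightModule (C : Type*) [Ring C] [Module C N] [SMulCommClass C B N] :
    Module C (BalancedTensor B M N) :=
  Module.compHom (R := AddMonoid.End (BalancedTensor B M N)) _
    { toFun := fun c => map LinearMap.id (DistribSMul.toLinearMap B N c)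
      map_one' := hom_ext fun m n => congrArg (tmul B m) (one_smul C n)
      map_mul' := fun c c' => hom_ext fun m n => congrArg (tmul B m) (mul_smul c c' n)
      map_zero' := hom_ext fun m n => (congrArg (tmul B m) (zero_smul C n)).trans (tmul_zero m)
      map_add' := fun c c' => hom_ext fun m n =>
        (congrArg (tmul B m) (add_smul c c' n)).trans (tmul_add m _ _) }

end BalancedTensor

end BalancedTensor

/-! ### Bimodules over `k`-algebras -/

/-- An `A`-`B`-bimodule over the field `k`; the right action of `B` is an action of `Bᵐᵒᵖ`, and
`k` acts in the same way through `A` and through `B`. -/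
structure AlgBimodule (k A B : Type u) [Field k] [Ring A] [Algebra k A] [Ring B] [Algebra k B] where
  carrier : Type u
  [addCommGroup : AddCommGroup carrier]
  [module : Module k carrier]
  [left : Module A carrier]
  [right : Module Bᵐᵒᵖ carrier]
  [leftTower : IsScalarTower k A carrier]
  [rightTower : IsScalarTower k Bᵐᵒᵖ carrier]
  [smulComm : SMulCommClass A Bᵐᵒᵖ carrier]

namespace AlgBimodule

attribute [instance] addCommGroup module left right leftTower rightTower smulComm

variable {k A B C : Type u} [Field k] [Ring A] [Algebra k A] [Ring B] [Algebra k B]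
  [Ring C] [Algebra k C]

instance : CoeSort (AlgBimodule k A B) (Type u) := ⟨carrier⟩

/-- An isomorphism of bimodules. -/
structure Iso (M N : AlgBimodule k A B) extends M.carrier ≃ₗ[A] N.carrier where
  map_op_smul' : ∀ (b : Bᵐᵒᵖ) (m : M.carrier), toFun (b • m) = b • toFun m

variable (k A) in
/-- The regular bimodule. -/
def regular : AlgBimodule k A A where
  carrier := A

/-- The direct sum of two bimodules. -/
def prod (M N : AlgBimodule k A B) : AlgBimodule k A B where
  carrier := M × N

/-- Left-right projective bimodules: projective as a left module and as a right module. -/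
def IsLRProjective (M : AlgBimodule k A B) : Prop :=
  Module.Projective A M ∧ Module.Projective Bᵐᵒᵖ M

theorem algebraMap_smul_eq (M : AlgBimodule k A B) (c : k) (m : M) :
    algebraMap k A c • m = op (algebraMap k B c) • m := by
  rw [algebraMap_smul, ← MulOpposite.algebraMap_apply, algebraMap_smul]

/-- The tensor product of an `A`-`B`-bimodule and a `B`-`C`-bimodule over `B`, with
`a (m ⊗ n) c = (a m) ⊗ (n c)`. -/
def tensor (M : AlgBimodule k A B) (N : AlgBimodule k B C) : AlgBimodule k A C :=
  letI iA : Module A (BalancedTensor B M N) := BalancedTensor.leftModule B M N A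
  haveI : SMulCommClass Cᵐᵒᵖ B N := SMulCommClass.symm _ _ _
  letI iC : Module Cᵐᵒᵖ (BalancedTensor B M N) := BalancedTensor.rightModule B M N Cᵐᵒᵖ
  letI ik : Module k (BalancedTensor B M N) := Module.compHom _ (algebraMap k A)
  have hA : ∀ (a : A) (m : M) (n : N),
    a • BalancedTensor.tmul B m n = BalancedTensor.tmul B (a • m) n := fun _ _ _ => rfl
  have hC : ∀ (c : Cᵐᵒᵖ) (m : M) (n : N),
    c • BalancedTensor.tmul B m n = BalancedTensor.tmul B m (c • n) := fun _ _ _ => rfl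
  have hk : ∀ (x : k) (t : BalancedTensor B M N), x • t = algebraMap k A x • t := fun _ _ => rfl
  { carrier := BalancedTensor B M N
    leftTower := ⟨fun x a t => by rw [hk, Algebra.smul_def, mul_smul]⟩
    rightTower := ⟨fun x c t => by
      rw [hk]
      induction t using BalancedTensor.induction_on with
      | zero => simp only [smul_zero]
      | add s t hs ht => simp only [smul_add, hs, ht]
      | tmul m n =>
        rw [hC, hC, hA, M.algebraMap_smul_eq, BalancedTensor.smul_tmul, smul_assoc,
          algebraMap_smul]⟩
    smulComm := ⟨fun a c t => by
      induction t using BalancedTensor.induction_on with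
      | zero => simp only [smul_zero]
      | add s t hs ht => simp only [smul_add, hs, ht]
      | tmul m n => rw [hC, hA, hA, hC]⟩ }

/-- The left `A`-module `M ⊗_B X`, for an `A`-`B`-bimodule `M` and a left `B`-module `X`. -/
def tensorModule (M : AlgBimodule k A B) (X : ModuleCat.{u} B) : ModuleCat.{u} A :=
  letI : Module A (BalancedTensor B M X) := BalancedTensor.leftModule B M X A
  ModuleCat.of A (BalancedTensor B M X)

theorem tensorModule_finite (M : AlgBimodule k A B) [hM : Module.Finite k M]
    (X : ModuleCat.{u} B) [hX : Module.Finite B X] : Module.Finite A (M.tensorModule X) := by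
  have hM' : Module.Finite A M := Module.Finite.of_restrictScalars_finite k A M
  obtain ⟨s, hs⟩ := hM'
  obtain ⟨t, ht⟩ := hX
  let _ : Module A (BalancedTensor B M X) := BalancedTensor.leftModule B M X A
  have hA : ∀ (a : A) (m : M) (n : X),
    a • BalancedTensor.tmul B m n = BalancedTensor.tmul B (a • m) n := fun _ _ _ => rfl
  change Module.Finite A (BalancedTensor B M X)
  have hfin : (Set.image2 (BalancedTensor.tmul B) (s : Set M) (t : Set X)).Finite :=
    s.finite_toSet.image2 _ t.finite_toSet
  refine Module.Finite.of_fg_top (Submodule.fg_def.2 ⟨_, hfin, ?_⟩)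
  rw [eq_top_iff]
  rintro z -
  have key₁ : ∀ x ∈ t, ∀ m : M, BalancedTensor.tmul B m x ∈ Submodule.span A
      (Set.image2 (BalancedTensor.tmul B) (s : Set M) (t : Set X)) := by
    intro x hx m
    have hm : m ∈ Submodule.span A (s : Set M) := hs ▸ Submodule.mem_top
    induction hm using Submodule.span_induction with
    | mem m hm => exact Submodule.subset_span ⟨m, hm, x, hx, rfl⟩
    | zero => rw [BalancedTensor.zero_tmul]; exact Submodule.zero_mem _
    | add m m' _ _ h h' => rw [BalancedTensor.add_tmul]; exact Submodule.add_mem _ h h'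
    | smul a m _ h => rw [← hA]; exact Submodule.smul_mem _ a h
  have key₂ : ∀ (x : X) (m : M), BalancedTensor.tmul B m x ∈ Submodule.span A
      (Set.image2 (BalancedTensor.tmul B) (s : Set M) (t : Set X)) := by
    intro x
    have hx : x ∈ Submodule.span B (t : Set X) := ht ▸ Submodule.mem_top
    induction hx using Submodule.span_induction with
    | mem x hx => exact key₁ x hx
    | zero => intro m; rw [BalancedTensor.tmul_zero]; exact Submodule.zero_mem _
    | add x x' _ _ h h' =>
      intro m; rw [BalancedTensor.tmul_add]; exact Submodule.add_mem _ (h m) (h' m)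
    | smul b x _ h => intro m; rw [← BalancedTensor.smul_tmul]; exact h _
  induction z using BalancedTensor.induction_on with
  | zero => exact Submodule.zero_mem _
  | add x y hx hy => exact Submodule.add_mem _ hx hy
  | tmul m x => exact key₂ x m

/-- The map `M ⊗_B X → M ⊗_B Y` induced by a map `X → Y`. -/
def tensorModuleMap (M : AlgBimodule k A B) {X Y : ModuleCat.{u} B} (f : X ⟶ Y) :
    M.tensorModule X ⟶ M.tensorModule Y :=
  letI : Module A (BalancedTensor B M X) := BalancedTensor.leftModule B M X A
  letI : Module A (BalancedTensor B M Y) := BalancedTensor.leftModule B M Y A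
  ModuleCat.ofHom
    { toFun := BalancedTensor.map (LinearMap.id : M →ₗ[Bᵐᵒᵖ] M) f.hom
      map_add' := map_add _
      map_smul' := fun a t => by
        simp only [RingHom.id_apply]
        induction t using BalancedTensor.induction_on with
        | zero => simp only [smul_zero, map_zero]
        | add s t hs ht => simp only [smul_add, map_add, hs, ht]
        | tmul m n => rfl }

theorem tensorModuleMap_id (M : AlgBimodule k A B) (X : ModuleCat.{u} B) :
    M.tensorModuleMap (𝟙 X) = 𝟙 (M.tensorModule X) := by
  refine ModuleCat.hom_ext (LinearMap.toAddMonoidHom_injective ?_)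
  exact BalancedTensor.hom_ext fun m n => rfl

theorem tensorModuleMap_comp (M : AlgBimodule k A B) {X Y Z : ModuleCat.{u} B} (f : X ⟶ Y)
    (g : Y ⟶ Z) : M.tensorModuleMap (f ≫ g) = M.tensorModuleMap f ≫ M.tensorModuleMap g := by
  refine ModuleCat.hom_ext (LinearMap.toAddMonoidHom_injective ?_)
  exact BalancedTensor.hom_ext fun m n => rfl

/-- The functor `M ⊗_B -` from finitely generated left `B`-modules to finitely generated left
`A`-modules, for a finite-dimensional `A`-`B`-bimodule `M`. Over a finite-dimensional algebra, the
finitely generated modules are the finite-dimensional ones. -/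
def tensorFunctor (M : AlgBimodule k A B) [Module.Finite k M] :
    FGModuleCat.{u} B ⥤ FGModuleCat.{u} A where
  obj X := ⟨M.tensorModule X.obj, M.tensorModule_finite X.obj (hX := X.property)⟩
  map f := ObjectProperty.homMk (M.tensorModuleMap f.hom)
  map_id X := ObjectProperty.hom_ext _ (M.tensorModuleMap_id X.obj)
  map_comp f g := ObjectProperty.hom_ext _ (M.tensorModuleMap_comp f.hom g.hom)

end AlgBimodule

/-- Two `k`-algebras `A` and `B` are symmetrically separably equivalent if there are
finite-dimensional left-right projective bimodules `M` (an `A`-`B`-bimodule) and `N` (a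
`B`-`A`-bimodule) with bimodule isomorphisms `M ⊗_B N ≅ A ⊕ X` and `N ⊗_A M ≅ B ⊕ Y` such that
the functors `M ⊗_B -` and `N ⊗_A -` between the categories of finite-dimensional left modules
are biadjoint, that is, adjoint to each other on both sides. -/
def SymmetricallySeparablyEquivalent (k A B : Type u) [Field k] [Ring A] [Algebra k A]
    [Ring B] [Algebra k B] : Prop :=
  ∃ (M : AlgBimodule k A B) (N : AlgBimodule k B A)
    (_ : Module.Finite k M) (_ : Module.Finite k N),
    M.IsLRProjective ∧ N.IsLRProjective ∧
    (∃ X : AlgBimodule k A A, Nonempty ((M.tensor N).Iso ((AlgBimodule.regular k A).prod X))) ∧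
    (∃ Y : AlgBimodule k B B, Nonempty ((N.tensor M).Iso ((AlgBimodule.regular k B).prod Y))) ∧
    Nonempty (M.tensorFunctor ⊣ N.tensorFunctor) ∧
    Nonempty (N.tensorFunctor ⊣ M.tensorFunctor)

end

/-! Write `A` for the truncated polynomial ring, `B` for the Nakayama algebra and `s` for the sum of
all arrows. Sending `x` to `s` makes `B` an extension of `A`, and both bimodules are `B` itself:
over `A`-`B` it induces restriction, over `B`-`A` induction.

The extension is Frobenius. Let `E : B → A` send a path of length `l` to `x ^ l`, and let `e i` be
the idempotents at the vertices. A path of length `l` from `a` to `b` equals `s ^ l * e a` and also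
`e b * s ^ l`, because `s * e i = e (i + 1) * s`. Hence `E` is `A`-linear on both sides, and `b = ∑
E (b * e i) * e i = ∑ e i * E (e i * b)` for all `b` in `B`: the `e i` are dual to themselves. These
two expansions give projectivity over `A` and make restriction left adjoint to induction; the other
adjunction holds for every ring extension.

The extension is split: `E 1 = n` is invertible, so `n⁻¹ • E` sends the `A`-central element `1 ⊗ 1`
of `B ⊗_B B` to `1`, and `A` splits off. It is separable: `∑ e i ⊗ e i` in `B ⊗_A B` is `B`-central
and multiplies to `∑ e i = 1`, so `B` splits off.

The general part is `FrobeniusData.symmetricallySeparablyEquivalent`; the quiver enters through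
`arrowSum_mul_vertex` and `arrowIdeal_pow_le`, the latter making `E` well defined on the quotient.
-/

/-! ### Maps out of tensor products of bimodules and modules -/

namespace AlgBimodule

variable {k A B C : Type u} [Field k] [Ring A] [Algebra k A] [Ring B] [Algebra k B]
  [Ring C] [Algebra k C]

section TensorModule

variable {X : ModuleCat.{u} B}

/-- A pure tensor in `M ⊗_B X`. -/
def pure (M : AlgBimodule k A B) (m : M) (x : X) : M.tensorModule X :=
  BalancedTensor.tmul B m x

theorem smul_pure (M : AlgBimodule k A B) (a : A) (m : M) (x : X) :
    a • M.pure m x = M.pure (a • m) x := rfl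

theorem pure_smul (M : AlgBimodule k A B) (b : B) (m : M) (x : X) :
    M.pure m (b • x) = M.pure (op b • m) x := (BalancedTensor.smul_tmul b m x).symm

theorem add_pure (M : AlgBimodule k A B) (m m' : M) (x : X) :
    M.pure (m + m') x = M.pure m x + M.pure m' x := BalancedTensor.add_tmul m m' x

theorem pure_add (M : AlgBimodule k A B) (m : M) (x x' : X) :
    M.pure m (x + x') = M.pure m x + M.pure m x' := BalancedTensor.tmul_add m x x'

/-- The pure tensors as a biadditive map. -/
def pureHom (M : AlgBimodule k A B) (X : ModuleCat.{u} B) : M →+ X →+ M.tensorModule X :=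
  AddMonoidHom.mk' (fun m => AddMonoidHom.mk' (M.pure m) (M.pure_add m))
    fun m m' => AddMonoidHom.ext fun x => M.add_pure m m' x

theorem sum_pure (M : AlgBimodule k A B) {ι : Type*} (s : Finset ι) (m : ι → M) (x : X) :
    M.pure (∑ i ∈ s, m i) x = ∑ i ∈ s, M.pure (m i) x :=
  map_sum ((M.pureHom X).flip x) m s

theorem pure_sum (M : AlgBimodule k A B) {ι : Type*} (s : Finset ι) (m : M) (x : ι → X) :
    M.pure m (∑ i ∈ s, x i) = ∑ i ∈ s, M.pure m (x i) :=
  map_sum (M.pureHom X m) x s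

theorem tensorModule_induction (M : AlgBimodule k A B) {P : M.tensorModule X → Prop}
    (t : M.tensorModule X) (zero : P 0) (pure : ∀ m x, P (M.pure m x))
    (add : ∀ s t, P s → P t → P (s + t)) : P t :=
  BalancedTensor.induction_on t zero pure add

theorem tensorModule_hom_ext (M : AlgBimodule k A B) {Y : Type*} [AddCommGroup Y] [Module A Y]
    {f g : M.tensorModule X →ₗ[A] Y} (h : ∀ m x, f (M.pure m x) = g (M.pure m x)) : f = g := by
  ext t
  induction t using tensorModule_induction with
  | zero => simp
  | pure m x => exact h m x
  | add s t hs ht => simp [hs, ht]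

/-- The additive map out of `M ⊗_B X` given by a balanced biadditive map. -/
def liftAdd (M : AlgBimodule k A B) {Y : Type*} [AddCommGroup Y]
    (f : M →+ X →+ Y) (hf : ∀ m (b : B) x, f (op b • m) x = f m (b • x)) :
    M.tensorModule X →+ Y :=
  BalancedTensor.lift f hf

/-- The linear map out of `M ⊗_B X` given by a balanced biadditive map that is linear in the
first argument. -/
def liftLinear (M : AlgBimodule k A B) {Y : Type*} [AddCommGroup Y] [Module A Y]
    (f : M →+ X →+ Y) (hf : ∀ m (b : B) x, f (op b • m) x = f m (b • x))
    (hA : ∀ (a : A) m x, f (a • m) x = a • f m x) : M.tensorModule X →ₗ[A] Y where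
  toFun := M.liftAdd f hf
  map_add' := map_add _
  map_smul' a t := by
    simp only [RingHom.id_apply]
    induction t using tensorModule_induction with
    | zero => simp only [smul_zero, map_zero]
    | pure m x => exact hA a m x
    | add s t hs ht => simp only [smul_add, map_add, hs, ht]

theorem tensorModuleMap_pure (M : AlgBimodule k A B) {Y : ModuleCat.{u} B} (f : X ⟶ Y) (m : M)
    (x : X) : (M.tensorModuleMap f).hom (M.pure m x) = M.pure m (f.hom x) := rfl

end TensorModule

section Tensor

/-- A pure tensor in `M ⊗_B N`. -/
def tpure (M : AlgBimodule k A B) (N : AlgBimodule k B C) (m : M) (n : N) : M.tensor N :=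
  BalancedTensor.tmul B m n

variable (M : AlgBimodule k A B) (N : AlgBimodule k B C)

theorem smul_tpure (a : A) (m : M) (n : N) :
    a • M.tpure N m n = M.tpure N (a • m) n := rfl

theorem op_smul_tpure (c : Cᵐᵒᵖ) (m : M) (n : N) :
    c • M.tpure N m n = M.tpure N m (c • n) := rfl

theorem tpure_smul (b : B) (m : M) (n : N) :
    M.tpure N m (b • n) = M.tpure N (op b • m) n := (BalancedTensor.smul_tmul b m n).symm

/-- The pure tensors as a biadditive map. -/
def tpureHom : M →+ N →+ M.tensor N :=
  AddMonoidHom.mk' (fun m => AddMonoidHom.mk' (M.tpure N m) (BalancedTensor.tmul_add m))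
    fun m m' => AddMonoidHom.ext fun x => BalancedTensor.add_tmul m m' x

theorem sum_tpure {ι : Type*} (s : Finset ι) (m : ι → M) (n : N) :
    M.tpure N (∑ i ∈ s, m i) n = ∑ i ∈ s, M.tpure N (m i) n :=
  map_sum ((M.tpureHom N).flip n) m s

theorem tpure_sum {ι : Type*} (s : Finset ι) (m : M) (n : ι → N) :
    M.tpure N m (∑ i ∈ s, n i) = ∑ i ∈ s, M.tpure N m (n i) :=
  map_sum (M.tpureHom N m) n s

theorem tensor_induction {P : M.tensor N → Prop} (t : M.tensor N) (zero : P 0)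
    (tpure : ∀ m n, P (M.tpure N m n)) (add : ∀ s t, P s → P t → P (s + t)) : P t :=
  BalancedTensor.induction_on t zero tpure add

/-- The additive map out of `M ⊗_B N` given by a balanced biadditive map. -/
def tensorLift {Y : Type*} [AddCommGroup Y] (f : M →+ N →+ Y)
    (hf : ∀ m (b : B) n, f (op b • m) n = f m (b • n)) : M.tensor N →+ Y :=
  BalancedTensor.lift f hf

end Tensor

/-! ### Bimodules with the regular bimodule as a direct summand -/

section Split

variable (P : AlgBimodule k A A) (r : P →ₗ[A] A) (hr : ∀ (a : A) p, r (op a • p) = r p * a)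

theorem op_smul_mem_ker (P : AlgBimodule k A A) (r : P →ₗ[A] A)
    (hr : ∀ (a : A) p, r (op a • p) = r p * a) (a : Aᵐᵒᵖ) {p : P} (hp : p ∈ LinearMap.ker r) :
    a • p ∈ LinearMap.ker r := by
  rw [LinearMap.mem_ker] at hp ⊢
  rw [← op_unop a, hr, hp, zero_mul]

/-- The kernel of a map from a bimodule to the regular bimodule. -/
def kernel : AlgBimodule k A A :=
  letI : SMul Aᵐᵒᵖ (LinearMap.ker r) := ⟨fun a p => ⟨a • p.1, op_smul_mem_ker P r hr a p.2⟩⟩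
  letI : Module Aᵐᵒᵖ (LinearMap.ker r) :=
    Function.Injective.module Aᵐᵒᵖ (LinearMap.ker r).subtype.toAddMonoidHom
      Subtype.val_injective fun _ _ => rfl
  { carrier := LinearMap.ker r
    rightTower := ⟨fun x b p => Subtype.ext (smul_assoc x b p.1)⟩
    smulComm := ⟨fun a b p => Subtype.ext (smul_comm a b p.1)⟩ }

/-- A map from a bimodule to the regular bimodule splits if it sends a central element to `1`. -/
def isoRegularProdKernel (z : P) (hz : ∀ a : A, a • z = op a • z) (hrz : r z = 1) :
    P.Iso ((regular k A).prod (kernel P r hr)) where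
  toFun p := (r p, ⟨p - r p • z, by simp [hrz]⟩)
  map_add' p q := Prod.ext (map_add r p q) (Subtype.ext (by
    change p + q - r (p + q) • z = (p - r p • z) + (q - r q • z)
    rw [map_add, add_smul]; abel))
  map_smul' a p := Prod.ext (map_smul r a p) (Subtype.ext (by
    change a • p - r (a • p) • z = a • (p - r p • z)
    rw [map_smul, smul_sub, smul_eq_mul, mul_smul]))
  invFun q := (show A from q.1) • z + q.2.1
  left_inv p := by
    change r p • z + (p - r p • z) = p
    abel
  right_inv q := by
    obtain ⟨a, p, hp⟩ := q
    have h : r ((show A from a) • z + p) = a := by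
      rw [map_add, map_smul, LinearMap.mem_ker.1 hp, hrz, smul_eq_mul, mul_one, add_zero]
    refine Prod.ext h (Subtype.ext ?_)
    change (show A from a) • z + p - r ((show A from a) • z + p) • z = p
    rw [h]; exact add_sub_cancel_left _ _
  map_op_smul' b p := by
    obtain ⟨b, rfl⟩ := op_surjective b
    refine Prod.ext (hr b p) (Subtype.ext ?_)
    change op b • p - r (op b • p) • z = op b • (p - r p • z)
    -- Centrality of `z` enters only here: it makes the section `a ↦ a • z` right linear.
    rw [hr, smul_sub, mul_smul, hz, smul_comm]

end Split

end AlgBimodule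

/-! ### Split separable Frobenius extensions -/

/-- A finite Frobenius extension `A → B` of `k`-algebras with Frobenius map `E` and a self-dual
pair of dual bases `e`, for which `∑ e i * e i = 1` and `E 1` is an invertible scalar. The second
condition says that the extension is separable, the third that it is split. -/
structure FrobeniusData (k A B : Type u) [Field k] [Ring A] [Algebra k A] [Ring B]
    [Algebra k B] where
  incl : A →ₐ[k] B
  trace : B →ₗ[k] A
  trace_mul : ∀ a b, trace (incl a * b) = a * trace b
  mul_trace : ∀ b a, trace (b * incl a) = trace b * a
  ι : Type
  [fintype : Fintype ι]
  e : ι → B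
  sum_trace_mul : ∀ b, ∑ i, incl (trace (b * e i)) * e i = b
  sum_mul_trace : ∀ b, ∑ i, e i * incl (trace (e i * b)) = b
  sum_mul_self : ∑ i, e i * e i = 1
  c : k
  smul_trace_one : c • trace 1 = 1

namespace FrobeniusData

attribute [instance] fintype

open AlgBimodule

variable {k A B : Type u} [Field k] [Ring A] [Algebra k A] [Ring B] [Algebra k B]
  (F : FrobeniusData k A B)

/-- The `A`-`B`-bimodule `B`. -/
def left : AlgBimodule k A B where
  carrier := B
  left := Module.compHom B F.incl.toRingHom
  leftTower := letI := Module.compHom B F.incl.toRingHom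
    ⟨fun x a b => by
      change F.incl (x • a) * b = x • (F.incl a * b)
      rw [map_smul, smul_mul_assoc]⟩
  smulComm := letI := Module.compHom B F.incl.toRingHom
    ⟨fun a b x => (mul_assoc (F.incl a) x b.unop).symm⟩

/-- The `B`-`A`-bimodule `B`. -/
def right : AlgBimodule k B A where
  carrier := B
  right := Module.compHom B F.incl.toRingHom.op
  rightTower := letI := Module.compHom B F.incl.toRingHom.op
    ⟨fun x a b => by
      change b * F.incl (x • a.unop) = x • (b * F.incl a.unop)
      rw [map_smul, mul_smul_comm]⟩
  smulComm := letI := Module.compHom B F.incl.toRingHom.op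
    ⟨fun b a x => (mul_assoc b x (F.incl a.unop)).symm⟩

/-- An element of `B` as an element of the `A`-`B`-bimodule `B`. -/
def toLeft : B ≃+ F.left := AddEquiv.refl B

/-- An element of `B` as an element of the `B`-`A`-bimodule `B`. -/
def toRight : B ≃+ F.right := AddEquiv.refl B

theorem smul_toLeft (a : A) (b : B) : a • F.toLeft b = F.toLeft (F.incl a * b) := rfl

theorem op_smul_toLeft (b' b : B) : op b' • F.toLeft b = F.toLeft (b * b') := rfl

theorem smul_toRight (b' b : B) : b' • F.toRight b = F.toRight (b' * b) := rfl

theorem op_smul_toRight (a : A) (b : B) : op a • F.toRight b = F.toRight (b * F.incl a) := rfl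

/-- Rewriting with this puts a variable of the bimodule in the form `F.toLeft b`, to which the
lemmas on the actions apply. -/
theorem left_forall {P : F.left → Prop} : (∀ m, P m) ↔ ∀ b, P (F.toLeft b) := Iff.rfl

theorem right_forall {P : F.right → Prop} : (∀ m, P m) ↔ ∀ b, P (F.toRight b) := Iff.rfl

/-! ### Finiteness and projectivity of the two bimodules -/

theorem finite (F : FrobeniusData k A B) [Module.Finite k A] : Module.Finite k B := by
  refine Module.Finite.of_surjective (M := F.ι → A)
    (∑ i, (LinearMap.mulRight k (F.e i) ∘ₗ F.incl.toLinearMap) ∘ₗ LinearMap.proj i) fun b => ?_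
  exact ⟨fun i => F.trace (b * F.e i), by simpa using F.sum_trace_mul b⟩

/-- The expansion `b = ∑ E (b * e i) * e i` makes `B` a direct summand of a free left `A`-module of
finite rank; on the right, `B` is free of rank one over itself. -/
theorem left_isLRProjective : F.left.IsLRProjective := by
  refine ⟨Module.Projective.of_split (M := F.ι → A)
    (i := { toFun := fun m i => F.trace (F.toLeft.symm m * F.e i)
            map_add' := ?_, map_smul' := ?_ })
    (s := { toFun := fun f => ∑ i, f i • F.toLeft (F.e i)
            map_add' := ?_, map_smul' := ?_ }) ?_, ?_⟩
  · intro x y; ext i; simp [add_mul]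
  · rw [forall_comm, F.left_forall]
    intro b a; ext i
    simp [smul_toLeft, mul_assoc, F.trace_mul]
  · intro f g; simp [add_smul, Finset.sum_add_distrib]
  · intro a f; simp [Finset.smul_sum, mul_smul]
  · refine LinearMap.ext (F.left_forall.2 fun b => ?_)
    simpa [smul_toLeft, ← map_sum] using F.sum_trace_mul b
  · let f : Bᵐᵒᵖ ≃ₗ[Bᵐᵒᵖ] F.left :=
      { opAddEquiv.symm.trans F.toLeft with map_smul' := fun _ _ => rfl }
    exact Module.Projective.of_equiv f

theorem right_isLRProjective : F.right.IsLRProjective := by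
  refine ⟨inferInstanceAs (Module.Projective B B), Module.Projective.of_split (M := F.ι → Aᵐᵒᵖ)
    (i := { toFun := fun m i => op (F.trace (F.e i * F.toRight.symm m))
            map_add' := ?_, map_smul' := ?_ })
    (s := { toFun := fun f => ∑ i, f i • F.toRight (F.e i)
            map_add' := ?_, map_smul' := ?_ }) ?_⟩
  · intro x y; ext i; simp [mul_add]
  · rw [forall_comm, F.right_forall]
    intro b a; ext i
    obtain ⟨a, rfl⟩ := op_surjective a
    simp [op_smul_toRight, ← mul_assoc, F.mul_trace]
  · intro f g; simp [add_smul, Finset.sum_add_distrib]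
  · intro a f; simp [Finset.smul_sum, mul_smul]
  · refine LinearMap.ext (F.right_forall.2 fun b => ?_)
    simpa [op_smul_toRight, ← map_sum] using F.sum_mul_trace b

/-! ### The splittings -/

/-- The normalized trace `B ⊗_B B → A`. -/
def traceTensor : (F.left.tensor F.right) →ₗ[A] A where
  toFun := F.left.tensorLift F.right
    (AddMonoidHom.mk' (fun m => AddMonoidHom.mk'
      (fun n => (F.c • F.trace (F.toLeft.symm m * F.toRight.symm n) : A))
      (by intro n n'; simp [mul_add])) (by intro m m'; ext n; simp [add_mul]))
    (by
      rw [F.left_forall]; intro b b'; rw [F.right_forall]; intro b''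
      simp [op_smul_toLeft, smul_toRight, mul_assoc])
  map_add' := map_add _
  map_smul' a t := by
    simp only [RingHom.id_apply]
    induction t using tensor_induction with
    | zero => simp only [smul_zero, map_zero]
    | add s t hs ht => simp only [smul_add, map_add, hs, ht]
    | tpure m n =>
      change (F.c • F.trace (F.incl a * F.toLeft.symm m * F.toRight.symm n) : A) =
        a * (F.c • F.trace (F.toLeft.symm m * F.toRight.symm n))
      rw [mul_assoc, F.trace_mul, mul_smul_comm]

theorem traceTensor_op_smul (a : A) (t : F.left.tensor F.right) :
    F.traceTensor (op a • t) = F.traceTensor t * a := by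
  induction t using tensor_induction with
  | zero => simp only [smul_zero, map_zero, zero_mul]
  | add s t hs ht => simp only [smul_add, map_add, hs, ht, add_mul]
  | tpure m n =>
    change (F.c • F.trace (F.toLeft.symm m * (F.toRight.symm n * F.incl a)) : A) =
      (F.c • F.trace (F.toLeft.symm m * F.toRight.symm n)) * a
    rw [← mul_assoc, F.mul_trace, smul_mul_assoc]

/-- The central element is `1 ⊗ 1`: the tensor product is over `B`, so elements of `A` pass through
it. -/
theorem exists_left_tensor_right_iso : ∃ X : AlgBimodule k A A,
    Nonempty ((F.left.tensor F.right).Iso ((regular k A).prod X)) := by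
  refine ⟨_, ⟨isoRegularProdKernel _ F.traceTensor F.traceTensor_op_smul
    (F.left.tpure F.right (F.toLeft 1) (F.toRight 1)) (fun a => ?_) ?_⟩⟩
  · rw [smul_tpure, op_smul_tpure, smul_toLeft, op_smul_toRight, one_mul, mul_one,
      ← mul_one (F.incl a), ← smul_toRight, tpure_smul, op_smul_toLeft, mul_one, one_mul]
  · change F.c • F.trace (1 * 1) = 1
    rw [mul_one, F.smul_trace_one]

/-- The multiplication `B ⊗_A B → B`. -/
def mulTensor : (F.right.tensor F.left) →ₗ[B] B where
  toFun := F.right.tensorLift F.left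
    (AddMonoidHom.mk' (fun m => AddMonoidHom.mk'
      (fun n => (F.toRight.symm m * F.toLeft.symm n : B))
      (by intro n n'; simp [mul_add])) (by intro m m'; ext n; simp [add_mul]))
    (by
      rw [F.right_forall]; intro b b'; rw [F.left_forall]; intro b''
      simp [op_smul_toRight, smul_toLeft, mul_assoc])
  map_add' := map_add _
  map_smul' a t := by
    simp only [RingHom.id_apply]
    induction t using tensor_induction with
    | zero => simp only [smul_zero, map_zero]
    | add s t hs ht => simp only [smul_add, map_add, hs, ht]
    | tpure m n => exact mul_assoc a (F.toRight.symm m) (F.toLeft.symm n)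

theorem mulTensor_op_smul (b : B) (t : F.right.tensor F.left) :
    F.mulTensor (op b • t) = F.mulTensor t * b := by
  induction t using tensor_induction with
  | zero => simp only [smul_zero, map_zero, zero_mul]
  | add s t hs ht => simp only [smul_add, map_add, hs, ht, add_mul]
  | tpure m n => exact (mul_assoc (F.toRight.symm m) (F.toLeft.symm n) b).symm

/-- The Casimir element `∑ e i ⊗ e i` is central. Expand the second factor `e i * b` in the `e j`,
move the coefficients, which lie in `A`, across the tensor sign, and collapse the sum over `i` with
the other expansion, applied to `b * e j`. -/
theorem sum_tpure_mul (b : B) :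
    ∑ i, F.right.tpure F.left (F.toRight (F.e i)) (F.toLeft (F.e i * b)) =
      ∑ i, F.right.tpure F.left (F.toRight (b * F.e i)) (F.toLeft (F.e i)) := by
  have h₁ : ∀ i, F.right.tpure F.left (F.toRight (F.e i)) (F.toLeft (F.e i * b)) =
      ∑ j, F.right.tpure F.left (F.toRight (F.e i * F.incl (F.trace (F.e i * b * F.e j))))
        (F.toLeft (F.e j)) := by
    intro i
    conv_lhs => rw [← F.sum_trace_mul (F.e i * b), map_sum, tpure_sum]
    refine Finset.sum_congr rfl fun j _ => ?_
    rw [← smul_toLeft, tpure_smul, op_smul_toRight]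
  simp only [h₁]
  rw [Finset.sum_comm]
  refine Finset.sum_congr rfl fun j _ => ?_
  rw [← sum_tpure, ← map_sum]
  simp only [mul_assoc, F.sum_mul_trace]

theorem exists_right_tensor_left_iso : ∃ Y : AlgBimodule k B B,
    Nonempty ((F.right.tensor F.left).Iso ((regular k B).prod Y)) := by
  refine ⟨_, ⟨isoRegularProdKernel _ F.mulTensor F.mulTensor_op_smul
    (∑ i, F.right.tpure F.left (F.toRight (F.e i)) (F.toLeft (F.e i))) (fun b => ?_) ?_⟩⟩
  · simp only [Finset.smul_sum, smul_tpure, op_smul_tpure, smul_toRight, op_smul_toLeft,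
      F.sum_tpure_mul]
  · rw [map_sum]
    exact F.sum_mul_self

/-! ### The adjunctions -/

/-- The counit `B ⊗_A (B ⊗_B Y) → Y` of induction and restriction, with the first factor fixed. -/
def indCounitAux (Y : ModuleCat.{u} B) (b : B) : F.left.tensorModule Y →+ Y :=
  F.left.liftAdd
    (AddMonoidHom.mk' (fun m => AddMonoidHom.mk' (fun y => (b * F.toLeft.symm m) • y) (smul_add _))
      (by intro m m'; ext y; simp [mul_add, add_smul]))
    (by
      rw [F.left_forall]; intro b b' y
      simp [op_smul_toLeft, mul_smul])

theorem indCounitAux_pure {Y : ModuleCat.{u} B} (b b' : B) (y : Y) :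
    F.indCounitAux Y b (F.left.pure (F.toLeft b') y) = (b * b') • y := rfl

/-- The counit `B ⊗_A (B ⊗_B Y) → Y` of induction and restriction. -/
def indCounit (Y : ModuleCat.{u} B) :
    F.right.tensorModule (F.left.tensorModule Y) →ₗ[B] Y :=
  F.right.liftLinear
    ((AddMonoidHom.mk' (F.indCounitAux Y) fun b b' => by
      ext t
      induction t using tensorModule_induction with
      | zero => simp only [map_zero]
      | pure m y =>
        revert m; rw [F.left_forall]; intro b''
        simp [indCounitAux_pure, add_mul, add_smul]
      | add s t hs ht => rw [map_add, hs, ht, map_add]).comp F.toRight.symm.toAddMonoidHom)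
    (by
      rw [F.right_forall]; intro b a t
      simp only [op_smul_toRight, AddMonoidHom.comp_apply, AddMonoidHom.mk'_apply,
        AddEquiv.toAddMonoidHom_eq_coe, AddMonoidHom.coe_coe, AddEquiv.symm_apply_apply]
      induction t using tensorModule_induction with
      | zero => simp only [smul_zero, map_zero]
      | pure m y =>
        revert m; rw [F.left_forall]; intro b'
        rw [smul_pure, smul_toLeft, indCounitAux_pure, indCounitAux_pure, mul_assoc]
      | add s t hs ht => rw [smul_add, map_add, hs, ht, map_add])
    (by
      intro a; rw [F.right_forall]; intro b t
      simp only [smul_toRight, AddMonoidHom.comp_apply, AddMonoidHom.mk'_apply,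
        AddEquiv.toAddMonoidHom_eq_coe, AddMonoidHom.coe_coe, AddEquiv.symm_apply_apply]
      induction t using tensorModule_induction with
      | zero => simp only [smul_zero, map_zero]
      | pure m y =>
        revert m; rw [F.left_forall]; intro b'
        rw [indCounitAux_pure, indCounitAux_pure, mul_assoc, mul_smul]
      | add s t hs ht => rw [map_add, hs, ht, map_add, smul_add])

theorem indCounit_pure {Y : ModuleCat.{u} B} (b b' : B) (y : Y) :
    F.indCounit Y (F.right.pure (F.toRight b) (F.left.pure (F.toLeft b') y)) = (b * b') • y :=
  rfl

/-- The counit `B ⊗_B (B ⊗_A X) → X` of restriction and induction, with the first factor fixed. -/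
def resCounitAux (X : ModuleCat.{u} A) (b : B) : F.right.tensorModule X →+ X :=
  F.right.liftAdd
    (AddMonoidHom.mk' (fun m => AddMonoidHom.mk'
        (fun y => F.trace (b * F.toRight.symm m) • y) (smul_add _))
      (by intro m m'; ext y; simp [mul_add, add_smul]))
    (by
      rw [F.right_forall]; intro b b' y
      simp [op_smul_toRight, ← mul_assoc, F.mul_trace, mul_smul])

theorem resCounitAux_pure {X : ModuleCat.{u} A} (b b' : B) (y : X) :
    F.resCounitAux X b (F.right.pure (F.toRight b') y) = F.trace (b * b') • y := rfl

/-- The counit `B ⊗_B (B ⊗_A X) → X` of restriction and induction. -/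
def resCounit (X : ModuleCat.{u} A) :
    F.left.tensorModule (F.right.tensorModule X) →ₗ[A] X :=
  F.left.liftLinear
    ((AddMonoidHom.mk' (F.resCounitAux X) fun b b' => by
      ext t
      induction t using tensorModule_induction with
      | zero => simp only [map_zero]
      | pure m y =>
        revert m; rw [F.right_forall]; intro b''
        simp [resCounitAux_pure, add_mul, add_smul]
      | add s t hs ht => rw [map_add, hs, ht, map_add]).comp F.toLeft.symm.toAddMonoidHom)
    (by
      rw [F.left_forall]; intro b a t
      simp only [op_smul_toLeft, AddMonoidHom.comp_apply, AddMonoidHom.mk'_apply,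
        AddEquiv.toAddMonoidHom_eq_coe, AddMonoidHom.coe_coe, AddEquiv.symm_apply_apply]
      induction t using tensorModule_induction with
      | zero => simp only [smul_zero, map_zero]
      | pure m y =>
        revert m; rw [F.right_forall]; intro b'
        rw [smul_pure, smul_toRight, resCounitAux_pure, resCounitAux_pure, mul_assoc]
      | add s t hs ht => rw [smul_add, map_add, hs, ht, map_add])
    (by
      intro a; rw [F.left_forall]; intro b t
      simp only [smul_toLeft, AddMonoidHom.comp_apply, AddMonoidHom.mk'_apply,
        AddEquiv.toAddMonoidHom_eq_coe, AddMonoidHom.coe_coe, AddEquiv.symm_apply_apply]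
      induction t using tensorModule_induction with
      | zero => simp only [smul_zero, map_zero]
      | pure m y =>
        revert m; rw [F.right_forall]; intro b'
        rw [resCounitAux_pure, resCounitAux_pure, mul_assoc, F.trace_mul, mul_smul]
      | add s t hs ht => rw [map_add, hs, ht, map_add, smul_add])

theorem resCounit_pure {X : ModuleCat.{u} A} (b b' : B) (x : X) :
    F.resCounit X (F.left.pure (F.toLeft b) (F.right.pure (F.toRight b') x)) =
      F.trace (b * b') • x :=
  rfl

/-- The unit `X → B ⊗_B (B ⊗_A X)` of induction and restriction. -/
def indUnit (X : ModuleCat.{u} A) : X →ₗ[A] F.left.tensorModule (F.right.tensorModule X) where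
  toFun x := F.left.pure (F.toLeft 1) (F.right.pure (F.toRight 1) x)
  map_add' x x' := by rw [AlgBimodule.pure_add, AlgBimodule.pure_add]
  map_smul' a x := by
    -- The scalar crosses both tensor signs: `1 ⊗ 1 ⊗ a x = 1 ⊗ a ⊗ x = a ⊗ 1 ⊗ x`.
    rw [RingHom.id_apply, smul_pure, AlgBimodule.pure_smul, op_smul_toRight, smul_toLeft, one_mul,
      mul_one, ← mul_one (F.incl a), ← smul_toRight, ← smul_pure, AlgBimodule.pure_smul,
      op_smul_toLeft, one_mul, mul_one]

/-- The computation of `sum_tpure_mul` with a module element attached; it makes `resUnit` linear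
over `B`. -/
theorem sum_pure_mul {Y : ModuleCat.{u} B} (b : B) (y : Y) :
    ∑ i, F.right.pure (F.toRight (F.e i)) (F.left.pure (F.toLeft (F.e i * b)) y) =
      ∑ i, F.right.pure (F.toRight (b * F.e i)) (F.left.pure (F.toLeft (F.e i)) y) := by
  have h₁ : ∀ i, F.right.pure (F.toRight (F.e i)) (F.left.pure (F.toLeft (F.e i * b)) y) =
      ∑ j, F.right.pure (F.toRight (F.e i * F.incl (F.trace (F.e i * b * F.e j))))
        (F.left.pure (F.toLeft (F.e j)) y) := by
    intro i
    conv_lhs => rw [← F.sum_trace_mul (F.e i * b), map_sum, sum_pure, pure_sum]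
    refine Finset.sum_congr rfl fun j _ => ?_
    rw [← smul_toLeft, ← smul_pure, AlgBimodule.pure_smul, op_smul_toRight]
  simp only [h₁]
  rw [Finset.sum_comm]
  refine Finset.sum_congr rfl fun j _ => ?_
  rw [← sum_pure, ← map_sum]
  simp only [mul_assoc, F.sum_mul_trace]

/-- The unit `Y → B ⊗_A (B ⊗_B Y)` of restriction and induction. -/
def resUnit (Y : ModuleCat.{u} B) : Y →ₗ[B] F.right.tensorModule (F.left.tensorModule Y) where
  toFun y := ∑ i, F.right.pure (F.toRight (F.e i)) (F.left.pure (F.toLeft (F.e i)) y)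
  map_add' x x' := by simp only [AlgBimodule.pure_add, Finset.sum_add_distrib]
  map_smul' b x := by
    simp only [RingHom.id_apply, AlgBimodule.pure_smul, op_smul_toLeft, F.sum_pure_mul,
      Finset.smul_sum, smul_pure, smul_toRight]

end FrobeniusData

/-! ### The two adjunctions between induction and restriction -/

namespace FrobeniusData

open AlgBimodule

variable {k A B : Type u} [Field k] [Ring A] [Algebra k A] [Ring B] [Algebra k B]
  (F : FrobeniusData k A B)

theorem tensorModule_tensorModule_hom_ext {C : Type u} [Ring C] [Algebra k C]
    (M : AlgBimodule k A B) (N : AlgBimodule k B C) {X : ModuleCat.{u} C} {Y : Type*}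
    [AddCommGroup Y] [Module A Y] {f g : M.tensorModule (N.tensorModule X) →ₗ[A] Y}
    (h : ∀ m n x, f (M.pure m (N.pure n x)) = g (M.pure m (N.pure n x))) : f = g := by
  refine M.tensorModule_hom_ext fun m t => ?_
  induction t using tensorModule_induction with
  | zero =>
    -- Both sides are additive in the inner tensor, here evaluated at zero.
    exact (map_zero (f.toAddMonoidHom.comp (M.pureHom _ m))).trans
      (map_zero (g.toAddMonoidHom.comp (M.pureHom _ m))).symm
  | pure n x => exact h m n x
  | add s t hs ht => rw [AlgBimodule.pure_add, map_add, map_add, hs, ht]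

/-- The map `indUnit` as a morphism of modules. -/
def indUnitHom (X : ModuleCat.{u} A) :
    X ⟶ F.left.tensorModule (F.right.tensorModule X) :=
  (ModuleCat.ofHom (F.indUnit X) :)

/-- The map `indCounit` as a morphism of modules. -/
def indCounitHom (Y : ModuleCat.{u} B) :
    F.right.tensorModule (F.left.tensorModule Y) ⟶ Y :=
  (ModuleCat.ofHom (F.indCounit Y) :)

/-- The map `resUnit` as a morphism of modules. -/
def resUnitHom (Y : ModuleCat.{u} B) :
    Y ⟶ F.right.tensorModule (F.left.tensorModule Y) :=
  (ModuleCat.ofHom (F.resUnit Y) :)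

/-- The map `resCounit` as a morphism of modules. -/
def resCounitHom (X : ModuleCat.{u} A) :
    F.left.tensorModule (F.right.tensorModule X) ⟶ X :=
  (ModuleCat.ofHom (F.resCounit X) :)

/-- Induction is left adjoint to restriction. -/
def indAdjunction [Module.Finite k F.left] [Module.Finite k F.right] :
    F.right.tensorFunctor ⊣ F.left.tensorFunctor where
  unit :=
    { app := fun X => ObjectProperty.homMk (F.indUnitHom X.obj)
      naturality := fun X Y f => by
        ext x
        rfl }
  counit :=
    { app := fun Y => ObjectProperty.homMk (F.indCounitHom Y.obj)
      naturality := fun X Y f => ObjectProperty.hom_ext _ (ModuleCat.hom_ext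
        (tensorModule_tensorModule_hom_ext _ _
          (F.right_forall.2 fun b => F.left_forall.2 fun b' x =>
          (map_smul f.hom.hom (b * b') x).symm))) }
  left_triangle_components X := ObjectProperty.hom_ext _ (ModuleCat.hom_ext
    (tensorModule_hom_ext _ (F.right_forall.2 fun b x => by
      change F.indCounit (F.right.tensorModule X.obj) (F.right.pure (F.toRight b)
        (F.left.pure (F.toLeft 1) (F.right.pure (F.toRight 1) x))) = F.right.pure (F.toRight b) x
      rw [indCounit_pure, smul_pure, smul_toRight, mul_one, mul_one])))
  right_triangle_components Y := ObjectProperty.hom_ext _ (ModuleCat.hom_ext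
    (tensorModule_hom_ext _ (F.left_forall.2 fun b y => by
      change F.left.pure (F.toLeft 1) (F.indCounit Y.obj (F.right.pure (F.toRight 1)
        (F.left.pure (F.toLeft b) y))) = F.left.pure (F.toLeft b) y
      rw [indCounit_pure, AlgBimodule.pure_smul, op_smul_toLeft, one_mul, one_mul])))

/-- Restriction is left adjoint to induction. -/
def resAdjunction [Module.Finite k F.left] [Module.Finite k F.right] :
    F.left.tensorFunctor ⊣ F.right.tensorFunctor where
  unit :=
    { app := fun Y => ObjectProperty.homMk (F.resUnitHom Y.obj)
      naturality := fun X Y f => by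
        ext x
        exact (map_sum (F.right.tensorModuleMap (F.left.tensorModuleMap f.hom)).hom
          (fun i => F.right.pure (F.toRight (F.e i)) (F.left.pure (F.toLeft (F.e i)) x))
          Finset.univ).symm }
  counit :=
    { app := fun X => ObjectProperty.homMk (F.resCounitHom X.obj)
      naturality := fun X Y f => ObjectProperty.hom_ext _ (ModuleCat.hom_ext
        (tensorModule_tensorModule_hom_ext _ _
          (F.left_forall.2 fun b => F.right_forall.2 fun b' x =>
          (map_smul f.hom.hom (F.trace (b * b')) x).symm))) }
  left_triangle_components Y := ObjectProperty.hom_ext _ (ModuleCat.hom_ext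
    (tensorModule_hom_ext _ (F.left_forall.2 fun b y => by
      change F.resCounit (F.left.tensorModule Y.obj) (F.left.pure (F.toLeft b)
        (∑ i, F.right.pure (F.toRight (F.e i)) (F.left.pure (F.toLeft (F.e i)) y))) =
          F.left.pure (F.toLeft b) y
      -- This triangle identity is the expansion `b = ∑ E (b * e i) * e i`, tensored with `y`.
      rw [pure_sum, map_sum]
      simp only [resCounit_pure, smul_pure, smul_toLeft]
      rw [← sum_pure, ← map_sum, F.sum_trace_mul])))
  right_triangle_components X := ObjectProperty.hom_ext _ (ModuleCat.hom_ext
    (tensorModule_hom_ext _ (F.right_forall.2 fun b x => by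
      change (F.right.tensorModuleMap (F.resCounitHom X.obj)).hom
        (∑ i, F.right.pure (F.toRight (F.e i)) (F.left.pure (F.toLeft (F.e i))
          (F.right.pure (F.toRight b) x))) = F.right.pure (F.toRight b) x
      -- This triangle identity is the other expansion, `b = ∑ e i * E (e i * b)`.
      rw [map_sum]
      simp only [tensorModuleMap_pure, resCounitHom, ModuleCat.hom_ofHom, resCounit_pure,
        AlgBimodule.pure_smul, op_smul_toRight]
      rw [← sum_pure, ← map_sum, F.sum_mul_trace])))

theorem symmetricallySeparablyEquivalent (F : FrobeniusData k A B) [Module.Finite k A] :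
    SymmetricallySeparablyEquivalent k A B := by
  have hB := F.finite
  have hl : Module.Finite k F.left := hB
  have hr : Module.Finite k F.right := hB
  exact ⟨F.left, F.right, hl, hr, F.left_isLRProjective, F.right_isLRProjective,
    F.exists_left_tensor_right_iso, F.exists_right_tensor_left_iso,
    ⟨F.resAdjunction⟩, ⟨F.indAdjunction⟩⟩

end FrobeniusData

noncomputable section

/-! ### The path algebra of the cyclic quiver -/

namespace CyclicQuiver

variable {n : ℕ} (k : Type u) [Field k]

/-- The idempotent of the path algebra at a vertex. -/
def vertex (i : CyclicQuiver n) : PathAlgebra k (CyclicQuiver n) :=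
  PathAlgebra.ofPath k (Quiver.Path.nil : Quiver.Path i i)

variable {k}

theorem vertex_mul_self (i : CyclicQuiver n) : vertex k i * vertex k i = vertex k i :=
  PathAlgebra.ofPath_mul_ofPath _ _

variable [NeZero n]

/-- The vertex that follows a given one. -/
def next (i : CyclicQuiver n) : CyclicQuiver n :=
  (⟨(i.toNat + 1) % n, Nat.mod_lt _ (NeZero.pos n)⟩ : Fin n)

/-- The arrow that starts at a given vertex. -/
def arrow (i : CyclicQuiver n) : i ⟶ i.next := ⟨rfl⟩

theorem eq_next_of_hom {i j : CyclicQuiver n} (α : i ⟶ j) : j = i.next := Fin.ext α.down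

/-- No two arrows share a target. By finiteness every vertex is then a successor, which
`pathTrace_mul_arrowSum` needs. -/
theorem next_injective : Function.Injective (next : CyclicQuiver n → CyclicQuiver n) := by
  intro i j h
  have h' : (i.toNat + 1) % n = (j.toNat + 1) % n := congrArg toNat h
  have hij : i.toNat ≡ j.toNat [MOD n] := Nat.ModEq.add_right_cancel' 1 h'
  exact Fin.ext (by simpa [Nat.ModEq, Nat.mod_eq_of_lt, Fin.is_lt i, Fin.is_lt j, toNat] using hij)

variable (n k) in
/-- The sum of all arrows. -/
def arrowSum : PathAlgebra k (CyclicQuiver n) :=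
  ∑ i : CyclicQuiver n, PathAlgebra.ofPath k (arrow i).toPath

/-- Of all arrows, only the one that starts at the end of `p` composes with `p`, and `α` must be
that arrow. -/
theorem arrowSum_mul_ofPath {a b c : CyclicQuiver n} (p : Quiver.Path a b) (α : b ⟶ c) :
    arrowSum n k * PathAlgebra.ofPath k p = PathAlgebra.ofPath k (p.cons α) := by
  obtain rfl := eq_next_of_hom α
  rw [arrowSum, Finset.sum_mul, Finset.sum_eq_single b]
  · exact PathAlgebra.ofPath_mul_ofPath _ _
  · exact fun i _ hi => PathAlgebra.ofPath_mul_ofPath_of_ne _ _ hi.symm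
  · simp

/-- Both sides are the single arrow from `i` to `i.next`: it alone starts at `i` and it alone ends
at `i.next`. -/
theorem arrowSum_mul_vertex (i : CyclicQuiver n) :
    arrowSum n k * vertex k i = vertex k i.next * arrowSum n k := by
  rw [vertex, arrowSum_mul_ofPath _ (arrow i), arrowSum, Finset.mul_sum, Finset.sum_eq_single i]
  · exact (PathAlgebra.ofPath_mul_ofPath Quiver.Path.nil (arrow i).toPath).symm
  · exact fun j _ hj => PathAlgebra.ofPath_mul_ofPath_of_ne _ _ (next_injective.ne hj)
  · simp

theorem ofPath_eq_pow_mul_vertex {a b : CyclicQuiver n} (p : Quiver.Path a b) :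
    PathAlgebra.ofPath k p = arrowSum n k ^ p.length * vertex k a := by
  induction p with
  | nil => rw [Quiver.Path.length_nil, pow_zero, one_mul, vertex]
  | cons p α ih =>
    rw [← arrowSum_mul_ofPath, ih, Quiver.Path.length_cons, pow_succ', mul_assoc]

theorem ofPath_eq_vertex_mul_pow {a b : CyclicQuiver n} (p : Quiver.Path a b) :
    PathAlgebra.ofPath k p = vertex k b * arrowSum n k ^ p.length := by
  induction p with
  | nil => rw [Quiver.Path.length_nil, pow_zero, mul_one, vertex]
  | cons p α ih =>
    obtain rfl := eq_next_of_hom α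
    rw [← arrowSum_mul_ofPath, ih, Quiver.Path.length_cons, pow_succ', ← mul_assoc,
      arrowSum_mul_vertex, mul_assoc]

/-- On a path, `s * (e b * s ^ l) = (e b.next * s ^ l) * s`. Hence the left ideal generated by `s`
is two-sided, and powers of `s` can be moved to the right. -/
theorem exists_arrowSum_mul_eq (y : PathAlgebra k (CyclicQuiver n)) :
    ∃ z, arrowSum n k * y = z * arrowSum n k := by
  induction y using PathAlgebra.induction_on with
  | zero => exact ⟨0, by rw [mul_zero, zero_mul]⟩
  | add x y hx hy =>
    obtain ⟨x', hx⟩ := hx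
    obtain ⟨y', hy⟩ := hy
    exact ⟨x' + y', by rw [mul_add, hx, hy, add_mul]⟩
  | smul c x hx =>
    obtain ⟨x', hx⟩ := hx
    exact ⟨c • x', by rw [mul_smul_comm, hx, smul_mul_assoc]⟩
  | path p =>
    rename_i a b
    refine ⟨vertex k b.next * arrowSum n k ^ p.length, ?_⟩
    rw [ofPath_eq_vertex_mul_pow, ← mul_assoc, arrowSum_mul_vertex, mul_assoc, mul_assoc,
      (Commute.self_pow _ _).eq]

theorem ofPath_toPath_eq {a b : CyclicQuiver n} (α : a ⟶ b) :
    PathAlgebra.ofPath k α.toPath = vertex k b * arrowSum n k := by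
  rw [ofPath_eq_vertex_mul_pow, Quiver.Path.length_toPath, pow_one]

theorem arrowIdeal_le :
    PathAlgebra.arrowIdeal k (CyclicQuiver n) ≤ Ideal.span {arrowSum n k} := by
  -- `Ideal.span` is a left ideal; it must be two-sided to be compared with the two-sided ideal of
  -- the arrows.
  have : (Ideal.span {arrowSum n k}).IsTwoSided := ⟨fun {x} y hx => by
    rw [Ideal.mem_span_singleton'] at hx ⊢
    obtain ⟨z, rfl⟩ := hx
    obtain ⟨w, hw⟩ := exists_arrowSum_mul_eq y
    exact ⟨z * w, by rw [mul_assoc, mul_assoc, hw]⟩⟩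
  intro x hx
  rw [← Ideal.mem_toTwoSided]
  refine TwoSidedIdeal.mem_span_iff.1 (TwoSidedIdeal.mem_asIdeal.1 hx) _ ?_
  rintro _ ⟨a, b, α, rfl⟩
  rw [SetLike.mem_coe, Ideal.mem_toTwoSided, Ideal.mem_span_singleton']
  exact ⟨_, (ofPath_toPath_eq α).symm⟩

theorem arrowIdeal_pow_le (m : ℕ) :
    PathAlgebra.arrowIdeal k (CyclicQuiver n) ^ m ≤ Ideal.span {arrowSum n k ^ m} := by
  induction m with
  | zero => rw [pow_zero, Ideal.span_singleton_one]; exact le_top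
  | succ m ih =>
    rw [Submodule.pow_succ, Ideal.mul_le]
    intro r hr s hs
    obtain ⟨y, rfl⟩ := Ideal.mem_span_singleton'.1 (ih hr)
    obtain ⟨z, rfl⟩ := Ideal.mem_span_singleton'.1 (arrowIdeal_le hs)
    -- This turns the product `(y * s ^ m) * (z * s)` into `y * w * s ^ (m + 1)`.
    have key : ∀ j : ℕ, ∃ w, arrowSum n k ^ j * z = w * arrowSum n k ^ j := fun j => by
      induction j with
      | zero => exact ⟨z, by simp⟩
      | succ j ih =>
        obtain ⟨w, hw⟩ := ih
        obtain ⟨w', hw'⟩ := exists_arrowSum_mul_eq w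
        exact ⟨w', by rw [pow_succ', mul_assoc, hw, ← mul_assoc, hw', mul_assoc]⟩
    obtain ⟨w, hw⟩ := key m
    refine Ideal.mem_span_singleton'.2 ⟨y * w, ?_⟩
    rw [pow_succ, mul_assoc y (_ ^ m), ← mul_assoc (_ ^ m) z, hw]
    simp only [mul_assoc]

/-- With this, `s ^ m` vanishes in the quotient, so `x ↦ s` is well defined on the truncated
polynomial ring. -/
theorem arrowSum_mem_arrowIdeal :
    arrowSum n k ∈ PathAlgebra.arrowIdeal k (CyclicQuiver n) :=
  Ideal.sum_mem _ fun i _ => TwoSidedIdeal.mem_asIdeal.2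
    (TwoSidedIdeal.subset_span ⟨i, i.next, arrow i, rfl⟩)

end CyclicQuiver

/-! ### Nakayama algebras as Frobenius extensions of truncated polynomial rings -/

namespace NakayamaAlgebra

open CyclicQuiver

variable (k : Type u) [Field k] (n m : ℕ)

/-- The truncated polynomial ring `k[x] / (x ^ m)`. -/
abbrev Truncated : Type u := k[X] ⧸ Ideal.span {(Polynomial.X : k[X]) ^ m}

/-- The class of the variable. -/
def Truncated.x : Truncated k m := Ideal.Quotient.mk _ Polynomial.X

theorem Truncated.x_pow : Truncated.x k m ^ m = 0 := by
  rw [Truncated.x, ← map_pow]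
  exact Ideal.Quotient.eq_zero_iff_mem.2 (Ideal.mem_span_singleton_self _)

instance Truncated.finite : Module.Finite k (Truncated k m) :=
  (Polynomial.monic_X_pow m).finite_quotient

/-- This form reduces linearity of the trace over the truncated polynomial ring to multiplication by
the variable. -/
theorem Truncated.induction_on {P : Truncated k m → Prop} (a : Truncated k m)
    (one : P 1) (x_mul : ∀ a, P a → P (Truncated.x k m * a))
    (add : ∀ a b, P a → P b → P (a + b)) (smul : ∀ (c : k) a, P a → P (c • a)) : P a := by
  obtain ⟨p, rfl⟩ := Ideal.Quotient.mk_surjective a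
  induction p using Polynomial.induction_on' with
  | add p q hp hq => rw [map_add]; exact add _ _ hp hq
  | monomial j c =>
    have h : ∀ j : ℕ, P (Truncated.x k m ^ j) := fun j => by
      induction j with
      | zero => rw [pow_zero]; exact one
      | succ j ih => rw [pow_succ']; exact x_mul _ ih
    have h' : Ideal.Quotient.mk (Ideal.span {(Polynomial.X : k[X]) ^ m})
        (Polynomial.monomial j c) = c • Truncated.x k m ^ j := by
      rw [Truncated.x, ← map_pow, ← Polynomial.smul_X_eq_monomial]
      rfl
    rw [h']
    exact smul c _ (h j)

/-! ### The trace on the path algebra and its descent to the quotient -/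

/-- The projection of the path algebra to the Nakayama algebra. -/
def proj : PathAlgebra k (CyclicQuiver n) →ₐ[k] NakayamaAlgebra k n m :=
  Ideal.Quotient.mkₐ k _

theorem proj_surjective : Function.Surjective (proj k n m) := Ideal.Quotient.mk_surjective

/-- The linear map that sends a path of length `l` to `x ^ l`. -/
def pathTrace : PathAlgebra k (CyclicQuiver n) →ₗ[k] Truncated k m :=
  (PathAlgebra.pathBasis k (CyclicQuiver n)).constr k fun p => Truncated.x k m ^ p.2.2.length

variable {k n m}

theorem pathTrace_ofPath {a b : CyclicQuiver n} (p : Quiver.Path a b) :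
    pathTrace k n m (PathAlgebra.ofPath k p) = Truncated.x k m ^ p.length :=
  Module.Basis.constr_basis _ _ _ _

theorem pathTrace_vertex (i : CyclicQuiver n) : pathTrace k n m (vertex k i) = 1 := by
  rw [vertex, pathTrace_ofPath, Quiver.Path.length_nil, pow_zero]

variable [NeZero n]

theorem pathTrace_arrowSum_mul (y : PathAlgebra k (CyclicQuiver n)) :
    pathTrace k n m (arrowSum n k * y) = Truncated.x k m * pathTrace k n m y := by
  induction y using PathAlgebra.induction_on with
  | zero => rw [mul_zero, map_zero, mul_zero]
  | add x y hx hy => rw [mul_add, map_add, hx, hy, map_add, mul_add]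
  | smul c x hx => rw [mul_smul_comm, map_smul, hx, map_smul, mul_smul_comm]
  | path p =>
    rw [arrowSum_mul_ofPath p (arrow _), pathTrace_ofPath, pathTrace_ofPath,
      Quiver.Path.length_cons, pow_succ']

theorem pathTrace_pow_mul_vertex (j : ℕ) (i : CyclicQuiver n) :
    pathTrace k n m (arrowSum n k ^ j * vertex k i) = Truncated.x k m ^ j := by
  induction j with
  | zero => rw [pow_zero, pow_zero, one_mul, pathTrace_vertex]
  | succ j ih => rw [pow_succ', pow_succ', mul_assoc, pathTrace_arrowSum_mul, ih]

theorem pathTrace_mul_arrowSum (y : PathAlgebra k (CyclicQuiver n)) :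
    pathTrace k n m (y * arrowSum n k) = pathTrace k n m y * Truncated.x k m := by
  induction y using PathAlgebra.induction_on with
  | zero => rw [zero_mul, map_zero, zero_mul]
  | add x y hx hy => rw [add_mul, map_add, hx, hy, map_add, add_mul]
  | smul c x hx => rw [smul_mul_assoc, map_smul, hx, map_smul, smul_mul_assoc]
  | path p =>
    rename_i a b
    -- The source of the path is `a.next` for some `a`, so that `e a.next * s = s * e a` applies to
    -- `p = s ^ l * e a.next`.
    obtain ⟨a, rfl⟩ := Finite.surjective_of_injective next_injective a
    rw [pathTrace_ofPath, ofPath_eq_pow_mul_vertex, mul_assoc, ← arrowSum_mul_vertex, ← mul_assoc,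
      ← pow_succ, pathTrace_pow_mul_vertex, pow_succ]

/-- Elements of the ideal power have the form `z * s ^ m`, and the trace turns the factor `s ^ m`
into `x ^ m = 0`. -/
theorem pathTrace_eq_zero (y : PathAlgebra k (CyclicQuiver n))
    (hy : y ∈ PathAlgebra.arrowIdeal k (CyclicQuiver n) ^ m) : pathTrace k n m y = 0 := by
  obtain ⟨z, rfl⟩ := Ideal.mem_span_singleton'.1 (arrowIdeal_pow_le m hy)
  have h : ∀ j : ℕ, pathTrace k n m (z * arrowSum n k ^ j) =
      pathTrace k n m z * Truncated.x k m ^ j := fun j => by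
    induction j with
    | zero => rw [pow_zero, pow_zero, mul_one, mul_one]
    | succ j ih => rw [pow_succ, pow_succ, ← mul_assoc, pathTrace_mul_arrowSum, ih, mul_assoc]
  rw [h, Truncated.x_pow, mul_zero]

variable (k n m)

/-- The embedding of the truncated polynomial ring that sends `x` to the sum of the arrows. -/
def incl : Truncated k m →ₐ[k] NakayamaAlgebra k n m :=
  Ideal.Quotient.liftₐ _ (Polynomial.aeval (proj k n m (arrowSum n k))) fun p hp => by
    obtain ⟨q, rfl⟩ := Ideal.mem_span_singleton'.1 hp
    rw [map_mul, map_pow, Polynomial.aeval_X, ← map_pow]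
    rw [show proj k n m (arrowSum n k ^ m) = 0 from
      Ideal.Quotient.eq_zero_iff_mem.2 (Ideal.pow_mem_pow arrowSum_mem_arrowIdeal m), mul_zero]

theorem incl_x : incl k n m (Truncated.x k m) = proj k n m (arrowSum n k) :=
  Polynomial.aeval_X (R := k) _

/-- The linear map from the Nakayama algebra to the truncated polynomial ring that sends a path of
length `l` to `x ^ l`. -/
def trace : NakayamaAlgebra k n m →ₗ[k] Truncated k m where
  -- The quotient by the ideal is definitionally the quotient by the underlying `k`-subspace.
  toFun := Submodule.liftQ
    ((PathAlgebra.arrowIdeal k (CyclicQuiver n) ^ m).restrictScalars k) (pathTrace k n m)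
    pathTrace_eq_zero
  map_add' x y := by
    obtain ⟨x, rfl⟩ := proj_surjective k n m x
    obtain ⟨y, rfl⟩ := proj_surjective k n m y
    exact map_add (pathTrace k n m) x y
  map_smul' c x := by
    obtain ⟨x, rfl⟩ := proj_surjective k n m x
    exact map_smul (pathTrace k n m) c x

variable {k n m}

/-! ### The Frobenius identities -/

theorem trace_proj (y : PathAlgebra k (CyclicQuiver n)) :
    trace k n m (proj k n m y) = pathTrace k n m y := rfl

theorem trace_mul (a : Truncated k m) (b : NakayamaAlgebra k n m) :
    trace k n m (incl k n m a * b) = a * trace k n m b := by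
  induction a using Truncated.induction_on generalizing b with
  | one => rw [map_one, one_mul, one_mul]
  | x_mul a ih =>
    rw [map_mul (incl k n m), mul_assoc, mul_assoc, ← ih]
    obtain ⟨y, hy⟩ := proj_surjective k n m (incl k n m a * b)
    rw [← hy, incl_x, ← map_mul, trace_proj, trace_proj, pathTrace_arrowSum_mul]
  | add a a' h h' => rw [map_add, add_mul, map_add, h, h', add_mul]
  | smul c a h => rw [map_smul, smul_mul_assoc, map_smul, h, smul_mul_assoc]

theorem mul_trace (b : NakayamaAlgebra k n m) (a : Truncated k m) :
    trace k n m (b * incl k n m a) = trace k n m b * a := by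
  -- The step for `x * a` uses the hypothesis at `b * incl x`, hence the generalization.
  induction a using Truncated.induction_on generalizing b with
  | one => rw [map_one, mul_one, mul_one]
  | x_mul a ih =>
    rw [map_mul (incl k n m), ← mul_assoc, ih, ← mul_assoc]
    obtain ⟨y, rfl⟩ := proj_surjective k n m b
    rw [incl_x, ← map_mul, trace_proj, trace_proj, pathTrace_mul_arrowSum]
  | add a a' h h' => rw [map_add, mul_add, map_add, h, h', mul_add]
  | smul c a h => rw [map_smul, mul_smul_comm, map_smul, h, mul_smul_comm]

/-- For a path `p` of length `l` from `a`, only the term of `a` survives, and it is `s ^ l * e a =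
p`. -/
theorem sum_trace_mul (b : NakayamaAlgebra k n m) :
    ∑ i, incl k n m (trace k n m (b * proj k n m (vertex k i))) * proj k n m (vertex k i) = b := by
  obtain ⟨y, rfl⟩ := proj_surjective k n m b
  induction y using PathAlgebra.induction_on with
  | zero => simp
  | add x y hx hy => simp only [map_add, add_mul, Finset.sum_add_distrib, hx, hy]
  | smul c x hx => simp only [map_smul, smul_mul_assoc, ← Finset.smul_sum, hx]
  | path p =>
    rename_i a b
    rw [Finset.sum_eq_single a]
    · rw [← map_mul, trace_proj, vertex, PathAlgebra.ofPath_mul_ofPath, Quiver.Path.nil_comp,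
        pathTrace_ofPath, map_pow, incl_x, ← map_pow, ← map_mul]
      exact congrArg _ (ofPath_eq_pow_mul_vertex p).symm
    · intro i _ hi
      rw [← map_mul, vertex, PathAlgebra.ofPath_mul_ofPath_of_ne _ _ hi, map_zero, map_zero,
        map_zero, zero_mul]
    · simp

/-- Mirror image: the surviving term is that of the target `b`, namely `e b * s ^ l = p`. -/
theorem sum_mul_trace (b : NakayamaAlgebra k n m) :
    ∑ i, proj k n m (vertex k i) * incl k n m (trace k n m (proj k n m (vertex k i) * b)) = b := by
  obtain ⟨y, rfl⟩ := proj_surjective k n m b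
  induction y using PathAlgebra.induction_on with
  | zero => simp
  | add x y hx hy => simp only [map_add, mul_add, Finset.sum_add_distrib, hx, hy]
  | smul c x hx => simp only [map_smul, mul_smul_comm, ← Finset.smul_sum, hx]
  | path p =>
    rename_i a b
    rw [Finset.sum_eq_single b]
    · rw [← map_mul, trace_proj, vertex, PathAlgebra.ofPath_mul_ofPath, Quiver.Path.comp_nil,
        pathTrace_ofPath, map_pow, incl_x, ← map_pow, ← map_mul]
      exact congrArg _ (ofPath_eq_vertex_mul_pow p).symm
    · intro i _ hi
      rw [← map_mul, vertex, PathAlgebra.ofPath_mul_ofPath_of_ne _ _ hi.symm, map_zero, map_zero,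
        map_zero, mul_zero]
    · simp

variable (k n m) in
/-- The Nakayama algebra as a Frobenius extension of the truncated polynomial ring. -/
def frobeniusData (hn : (n : k) ≠ 0) : FrobeniusData k (Truncated k m) (NakayamaAlgebra k n m) where
  incl := incl k n m
  trace := trace k n m
  trace_mul := trace_mul
  mul_trace := mul_trace
  ι := CyclicQuiver n
  e i := proj k n m (vertex k i)
  sum_trace_mul := sum_trace_mul
  sum_mul_trace := sum_mul_trace
  sum_mul_self := by
    simp only [← map_mul, vertex_mul_self]
    rw [← map_sum]
    exact map_one (proj k n m)
  c := (n : k)⁻¹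
  smul_trace_one := by
    have hcard : Fintype.card (CyclicQuiver n) = n := Fintype.card_fin n
    -- The unit is the sum of `n` paths of length zero, each of trace `1`.
    have h : trace k n m 1 = (n : k) • 1 := by
      rw [← map_one (proj k n m), trace_proj, PathAlgebra.one_def, map_sum]
      refine (Finset.sum_congr rfl fun i _ => pathTrace_vertex i).trans ?_
      rw [Finset.sum_const, Finset.card_univ, hcard, Nat.cast_smul_eq_nsmul]
    rw [h, smul_smul, inv_mul_cancel₀ hn, one_smul]

end NakayamaAlgebra

end

theorem proposition6p3 (k : Type u) [Field k] (n : ℕ) (hn : 2 ≤ n) (hchar : ¬ ringChar k ∣ n)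
    (m : ℕ) (hm : 2 ≤ m) :
    SymmetricallySeparablyEquivalent k (k[X] ⧸ Ideal.span {(Polynomial.X : k[X]) ^ m})
      (NakayamaAlgebra k n m) := by
  have : NeZero n := ⟨by lia⟩
  have := NakayamaAlgebra.Truncated.finite k m
  -- The characteristic does not divide `n`, so `E 1 = n` is invertible in `k`.
  exact (NakayamaAlgebra.frobeniusData k n m
    (mt (ringChar.spec k n).1 hchar)).symmetricallySeparablyEquivalent
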